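/- Let $G$ be a finite group. A symmetric sequence of $G$-sets is a family $S=(S_n)_{n\ge 0}$ of sets with left actions of $G\times\Sigma_n$; it is $\Sigma$-free if every $\Sigma_n$ acts freely on $S_n$. Let $\mathbb{F}(S)$ be the free (symmetric) operad in $G$-sets on $S$, i.e. $\mathbb{F}$ is left adjoint to the forgetful functor from operads in $G$-sets to symmetric sequences of $G$-sets. For a subgroup $H\subset G$ and a finite $H$-set $T$ with an ordering $T\cong\{1,\dots,n\}$ and associated permutation representation $\sigma:H\to\Sigma_n$, put $\Gamma_T=\{(h,\sigma(h)) : h\in H\}\subset G\times\Sigma_n$. The $H$-set $T$ is admissible for $S$ if $S_n^{\Gamma_T}\neq\varnothing$ (this does not depend on the ordering), and $\mathbb{A}(S)$ denotes the graded class of all admissible sets of $S$, for all $H\subset G$; for an operad, $\mathbb{A}$ is that of its underlying symmetric sequence. An indexing system is a graded class of finite $H$-sets ($H\subset G$) that contains all finite trivial actions and is closed under isomorphism, subobjects, restriction to subgroups, conjugation, finite coproducts, finite products, and self-induction (if $K\subset H$, $T$ is a $K$-set in the class, and $H/K$ is in the class, then $H\times_K T$ is in the class). For a graded class $C$, $\mathbb{I}(C)$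 denotes the smallest indexing system containing $C$. Theorem. Suppose $S$ is a $\Sigma$-free symmetric sequence of $G$-sets such that $S_0^G\neq\varnothing$ and $S_2^G\neq\varnothing$. Then the underlying symmetric sequence of $\mathbb{F}(S)$ is $\Sigma$-free, $\mathbb{F}(S)(n)^G\neq\varnothing$ for every $n\ge 0$, and $$\mathbb{A}(\mathbb{F}(S))=\mathbb{I}(\mathbb{A}(S)).$$ -/

import Mathlib

universe u v w

/-! ### Symmetric sequences of `G`-sets -/

/-- A symmetric sequence in `G`-sets: for every `n`, a set with a left action of `G × Σ_n`.
We think of `x : S.obj n` as an `n`-ary operation, on which `σ ∈ Σ_n` acts by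
`(σ • x) (c_1, …, c_n) = x (c_{σ 1}, …, c_{σ n})`. -/
structure SymmSeq (G : Type u) [Group G] where
  obj : ℕ → Type v
  [act : ∀ n, MulAction (G × Equiv.Perm (Fin n)) (obj n)]

attribute [instance] SymmSeq.act

/-- Transport of an operation along a bijection `e : Fin m ≃ Fin n` of its inputs
(so `m = n`). It combines the identification `X m = X n` with the action of a permutation;
on operations it is `(relabel e x) c = x (c ∘ e)`. -/
def relabel (G : Type u) [Group G] {X : ℕ → Type v}
    [∀ n, SMul (G × Equiv.Perm (Fin n)) (X n)] {m n : ℕ} (e : Fin m ≃ Fin n) (x : X m) : X n :=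
  have h : m = n := Fin.equiv_iff_eq.mp ⟨e⟩
  ((1 : G), (finCongr h).symm.trans e) • cast (congrArg X h) x

/-- For a permutation, `relabel` is the action. -/
theorem relabel_perm (G : Type u) [Group G] {X : ℕ → Type v}
    [∀ n, SMul (G × Equiv.Perm (Fin n)) (X n)] {n : ℕ} (σ : Equiv.Perm (Fin n)) (x : X n) :
    relabel G σ x = ((1 : G), σ) • x := rfl

theorem map_relabel (G : Type u) [Group G] {X : ℕ → Type v} {Y : ℕ → Type w}
    [∀ n, SMul (G × Equiv.Perm (Fin n)) (X n)] [∀ n, SMul (G × Equiv.Perm (Fin n)) (Y n)]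
    (f : ∀ n, X n → Y n)
    (hf : ∀ n (a : G × Equiv.Perm (Fin n)) (x : X n), f n (a • x) = a • f n x)
    {m n : ℕ} (e : Fin m ≃ Fin n) (x : X m) :
    f n (relabel G e x) = relabel G e (f m x) := by
  obtain rfl : m = n := Fin.equiv_iff_eq.mp ⟨e⟩
  exact hf _ _ _

namespace SymmSeq

variable {G : Type u} [Group G]

/-- Morphisms of symmetric sequences of `G`-sets. -/
@[ext]
structure Hom (S : SymmSeq.{u, v} G) (T : SymmSeq.{u, w} G) where
  toFun : ∀ n, S.obj n → T.obj n
  map_smul : ∀ n (a : G × Equiv.Perm (Fin n)) (x : S.obj n), toFun n (a • x) = a • toFun n x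

/-- `S` is `Σ`-free: every `Σ_n` acts freely on `S_n`. -/
def SigmaFree (S : SymmSeq.{u, v} G) : Prop :=
  ∀ (n : ℕ) (x : S.obj n) (σ : Equiv.Perm (Fin n)), ((1 : G), σ) • x = x → σ = 1

/-- The `G`-fixed points `S_n^G`. -/
def gFixed (S : SymmSeq.{u, v} G) (n : ℕ) : Set (S.obj n) :=
  {x | ∀ g : G, (g, (1 : Equiv.Perm (Fin n))) • x = x}

end SymmSeq

/-! ### Operads in `G`-sets

The sum `j_1 + ⋯ + j_k` is identified with the disjoint union of blocks through the
lexicographic bijection `finSigmaFinEquiv : (Σ i, Fin (j i)) ≃ Fin (∑ i, j i)`. -/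

/-- The input `b` of block `i` (for the reindexed block sizes `j ∘ σ`) goes to the input `b` of
block `σ i`. -/
def blockPerm {k : ℕ} (j : Fin k → ℕ) (σ : Equiv.Perm (Fin k)) :
    Fin (∑ i, j (σ i)) ≃ Fin (∑ i, j i) :=
  finSigmaFinEquiv.symm.trans
    ((Equiv.sigmaCongrLeft (β := fun i => Fin (j i)) σ).trans finSigmaFinEquiv)

/-- The block sum `τ_1 ⊕ ⋯ ⊕ τ_k`. -/
def blockSum {k : ℕ} (j : Fin k → ℕ) (τ : ∀ i, Equiv.Perm (Fin (j i))) :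
    Equiv.Perm (Fin (∑ i, j i)) :=
  finSigmaFinEquiv.symm.trans ((Equiv.sigmaCongrRight τ).trans finSigmaFinEquiv)

/-- The identification of `1 + ⋯ + 1` (`k` terms) with `k`. -/
def sumOnes (k : ℕ) : Fin (∑ _i : Fin k, 1) ≃ Fin k :=
  finSigmaFinEquiv.symm.trans (Equiv.sigmaUnique (Fin k) (fun _ => Fin 1))

/-- The identification of a sum with the single term `n` with `n`. -/
def sumSingle (n : ℕ) : Fin (∑ _i : Fin 1, n) ≃ Fin n :=
  finSigmaFinEquiv.symm.trans (Equiv.uniqueSigma (fun _ : Fin 1 => Fin n))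

/-- The lexicographic identification of an iterated sum over `i` and `b < j i`
with a single sum over the `∑ i, j i` pairs `(i, b)`. -/
def sumAssoc {k : ℕ} (j : Fin k → ℕ) (l : Fin (∑ i, j i) → ℕ) :
    Fin (∑ i, ∑ b, l (finSigmaFinEquiv ⟨i, b⟩)) ≃ Fin (∑ a, l a) :=
  finSigmaFinEquiv.symm.trans <|
    (Equiv.sigmaCongrRight fun _ => finSigmaFinEquiv.symm).trans <|
      (Equiv.sigmaAssoc fun i b => Fin (l (finSigmaFinEquiv ⟨i, b⟩))).symm.trans <|
        (Equiv.sigmaCongrLeft (β := fun a => Fin (l a)) finSigmaFinEquiv).trans finSigmaFinEquiv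

/-- An operad in the category of `G`-sets: a symmetric sequence with a `G`-fixed identity and
with `G`-equivariant composition operations `γ` that are equivariant for the symmetric groups,
unital and associative. -/
structure GOperad (G : Type u) [Group G] extends SymmSeq.{u, v} G where
  one : obj 1
  γ : ∀ {k : ℕ} (j : Fin k → ℕ), obj k → (∀ i, obj (j i)) → obj (∑ i, j i)
  smul_one : ∀ g : G, (g, (1 : Equiv.Perm (Fin 1))) • one = one
  smul_γ : ∀ (g : G) {k : ℕ} (j : Fin k → ℕ) (x : obj k) (y : ∀ i, obj (j i)),
    (g, (1 : Equiv.Perm (Fin (∑ i, j i)))) • γ j x y =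
      γ j ((g, (1 : Equiv.Perm (Fin k))) • x)
        (fun i => (g, (1 : Equiv.Perm (Fin (j i)))) • y i)
  γ_perm_left : ∀ {k : ℕ} (j : Fin k → ℕ) (σ : Equiv.Perm (Fin k)) (x : obj k)
    (y : ∀ i, obj (j i)),
    γ j (((1 : G), σ) • x) y =
      relabel G (blockPerm j σ) (γ (fun i => j (σ i)) x (fun i => y (σ i)))
  γ_perm_right : ∀ {k : ℕ} (j : Fin k → ℕ) (τ : ∀ i, Equiv.Perm (Fin (j i))) (x : obj k)
    (y : ∀ i, obj (j i)),
    γ j x (fun i => ((1 : G), τ i) • y i) = ((1 : G), blockSum j τ) • γ j x y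
  γ_one : ∀ {k : ℕ} (x : obj k), relabel G (sumOnes k) (γ (fun _ => 1) x (fun _ => one)) = x
  one_γ : ∀ {n : ℕ} (y : obj n),
    relabel G (sumSingle n) (γ (fun _ : Fin 1 => n) one (fun _ => y)) = y
  γ_assoc : ∀ {k : ℕ} (j : Fin k → ℕ) (l : Fin (∑ i, j i) → ℕ) (x : obj k)
    (y : ∀ i, obj (j i)) (z : ∀ a, obj (l a)),
    γ l (γ j x y) z =
      relabel G (sumAssoc j l)
        (γ (fun i => ∑ b, l (finSigmaFinEquiv ⟨i, b⟩)) x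
          (fun i => γ (fun b => l (finSigmaFinEquiv ⟨i, b⟩)) (y i)
            (fun b => z (finSigmaFinEquiv ⟨i, b⟩))))

namespace GOperad

variable {G : Type u} [Group G]

/-- Morphisms of operads in `G`-sets. -/
@[ext]
structure Hom (O : GOperad.{u, v} G) (P : GOperad.{u, w} G) extends
    SymmSeq.Hom O.toSymmSeq P.toSymmSeq where
  map_one : toFun 1 O.one = P.one
  map_γ : ∀ {k : ℕ} (j : Fin k → ℕ) (x : O.obj k) (y : ∀ i, O.obj (j i)),
    toFun _ (O.γ j x y) = P.γ j (toFun k x) (fun i => toFun (j i) (y i))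

/-- The objects of the category `NOp`: operads in `G`-sets that are `Σ`-free and have a
`G`-fixed operation of every arity. -/
structure IsNOperad (O : GOperad.{u, v} G) : Prop where
  sigmaFree : O.toSymmSeq.SigmaFree
  gFixed_nonempty : ∀ n, (O.toSymmSeq.gFixed n).Nonempty

end GOperad

/-! ### The free operad on a symmetric sequence

It is built as formal composites of elements of `S`, modulo the smallest congruence that forces
the operad axioms and makes the inclusion of `S` equivariant. The universal property is proved
below. -/

section Free

variable {G : Type u} [Group G]

/-- Formal operadic expressions in elements of `S`. -/
inductive FreeTerm (S : SymmSeq.{u, v} G) : ℕ → Type (max u v)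
  | of {n : ℕ} (s : S.obj n) : FreeTerm S n
  | one : FreeTerm S 1
  | smul {n : ℕ} (a : G × Equiv.Perm (Fin n)) (t : FreeTerm S n) : FreeTerm S n
  | comp {k : ℕ} (j : Fin k → ℕ) (t : FreeTerm S k) (r : ∀ i, FreeTerm S (j i)) :
      FreeTerm S (∑ i, j i)

instance (S : SymmSeq.{u, v} G) (n : ℕ) : SMul (G × Equiv.Perm (Fin n)) (FreeTerm S n) :=
  ⟨FreeTerm.smul⟩

/-- The congruence generated by the operad axioms and the equivariance of `of`. -/
inductive FreeRel (S : SymmSeq.{u, v} G) : ∀ {n : ℕ}, FreeTerm S n → FreeTerm S n → Prop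
  | refl {n : ℕ} (t : FreeTerm S n) : FreeRel S t t
  | symm {n : ℕ} {t t' : FreeTerm S n} : FreeRel S t t' → FreeRel S t' t
  | trans {n : ℕ} {t t' t'' : FreeTerm S n} :
      FreeRel S t t' → FreeRel S t' t'' → FreeRel S t t''
  | smul_congr {n : ℕ} (a : G × Equiv.Perm (Fin n)) {t t' : FreeTerm S n} :
      FreeRel S t t' → FreeRel S (a • t) (a • t')
  | comp_congr {k : ℕ} (j : Fin k → ℕ) {t t' : FreeTerm S k} {r r' : ∀ i, FreeTerm S (j i)} :
      FreeRel S t t' → (∀ i, FreeRel S (r i) (r' i)) →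
        FreeRel S (.comp j t r) (.comp j t' r')
  | of_smul {n : ℕ} (a : G × Equiv.Perm (Fin n)) (s : S.obj n) :
      FreeRel S (.of (a • s)) (a • .of s)
  | one_smul {n : ℕ} (t : FreeTerm S n) : FreeRel S ((1 : G × Equiv.Perm (Fin n)) • t) t
  | mul_smul {n : ℕ} (a b : G × Equiv.Perm (Fin n)) (t : FreeTerm S n) :
      FreeRel S ((a * b) • t) (a • b • t)
  | smul_one (g : G) : FreeRel S ((g, (1 : Equiv.Perm (Fin 1))) • .one) .one
  | smul_comp (g : G) {k : ℕ} (j : Fin k → ℕ) (t : FreeTerm S k) (r : ∀ i, FreeTerm S (j i)) :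
      FreeRel S ((g, (1 : Equiv.Perm (Fin (∑ i, j i)))) • .comp j t r)
        (.comp j ((g, (1 : Equiv.Perm (Fin k))) • t)
          (fun i => (g, (1 : Equiv.Perm (Fin (j i)))) • r i))
  | comp_perm_left {k : ℕ} (j : Fin k → ℕ) (σ : Equiv.Perm (Fin k)) (t : FreeTerm S k)
      (r : ∀ i, FreeTerm S (j i)) :
      FreeRel S (.comp j (((1 : G), σ) • t) r)
        (relabel G (blockPerm j σ) (.comp (fun i => j (σ i)) t (fun i => r (σ i))))
  | comp_perm_right {k : ℕ} (j : Fin k → ℕ) (τ : ∀ i, Equiv.Perm (Fin (j i)))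
      (t : FreeTerm S k) (r : ∀ i, FreeTerm S (j i)) :
      FreeRel S (.comp j t (fun i => ((1 : G), τ i) • r i))
        (((1 : G), blockSum j τ) • .comp j t r)
  | comp_one {k : ℕ} (t : FreeTerm S k) :
      FreeRel S (relabel G (sumOnes k) (.comp (fun _ => 1) t (fun _ => .one))) t
  | one_comp {n : ℕ} (t : FreeTerm S n) :
      FreeRel S (relabel G (sumSingle n) (.comp (fun _ : Fin 1 => n) .one (fun _ => t))) t
  | comp_assoc {k : ℕ} (j : Fin k → ℕ) (l : Fin (∑ i, j i) → ℕ) (t : FreeTerm S k)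
      (r : ∀ i, FreeTerm S (j i)) (q : ∀ a, FreeTerm S (l a)) :
      FreeRel S (.comp l (.comp j t r) q)
        (relabel G (sumAssoc j l)
          (.comp (fun i => ∑ b, l (finSigmaFinEquiv ⟨i, b⟩)) t
            (fun i => .comp (fun b => l (finSigmaFinEquiv ⟨i, b⟩)) (r i)
              (fun b => q (finSigmaFinEquiv ⟨i, b⟩)))))

def freeSetoid (S : SymmSeq.{u, v} G) (n : ℕ) : Setoid (FreeTerm S n) where
  r := FreeRel S
  iseqv := ⟨FreeRel.refl, FreeRel.symm, FreeRel.trans⟩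

/-- The `n`-ary operations of the free operad on `S`. -/
def FreeObj (S : SymmSeq.{u, v} G) (n : ℕ) : Type (max u v) := Quotient (freeSetoid S n)

/-- The class of a formal expression. -/
def FreeObj.mk {S : SymmSeq.{u, v} G} {n : ℕ} (t : FreeTerm S n) : FreeObj S n :=
  Quotient.mk (freeSetoid S n) t

theorem FreeObj.sound {S : SymmSeq.{u, v} G} {n : ℕ} {t t' : FreeTerm S n}
    (h : FreeRel S t t') : FreeObj.mk t = FreeObj.mk t' :=
  Quotient.sound (s := freeSetoid S n) h

theorem FreeObj.exists_mk {S : SymmSeq.{u, v} G} {n : ℕ} (x : FreeObj S n) :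
    ∃ t, FreeObj.mk t = x :=
  Quotient.exists_rep x

instance (S : SymmSeq.{u, v} G) (n : ℕ) : MulAction (G × Equiv.Perm (Fin n)) (FreeObj S n) where
  smul a := Quotient.map (sa := freeSetoid S n) (sb := freeSetoid S n) (fun t => a • t)
    (fun _ _ h => FreeRel.smul_congr a h)
  one_smul := by
    rintro ⟨t⟩
    exact FreeObj.sound (.one_smul t)
  mul_smul := by
    rintro a b ⟨t⟩
    exact FreeObj.sound (.mul_smul a b t)

/-- Composition of classes of formal expressions. -/
noncomputable def FreeObj.comp {S : SymmSeq.{u, v} G} {k : ℕ} (j : Fin k → ℕ) (x : FreeObj S k)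
    (y : ∀ i, FreeObj S (j i)) : FreeObj S (∑ i, j i) :=
  FreeObj.mk (.comp j (Quotient.out x) (fun i => Quotient.out (y i)))

theorem FreeObj.comp_mk {S : SymmSeq.{u, v} G} {k : ℕ} (j : Fin k → ℕ) (t : FreeTerm S k)
    (r : ∀ i, FreeTerm S (j i)) :
    FreeObj.comp j (FreeObj.mk t) (fun i => FreeObj.mk (r i)) = FreeObj.mk (.comp j t r) :=
  FreeObj.sound (.comp_congr j (Quotient.exact (Quotient.out_eq (FreeObj.mk t)))
    (fun i => Quotient.exact (Quotient.out_eq (FreeObj.mk (r i)))))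

theorem FreeObj.relabel_mk {S : SymmSeq.{u, v} G} {m n : ℕ} (e : Fin m ≃ Fin n)
    (t : FreeTerm S m) : relabel G e (FreeObj.mk t) = FreeObj.mk (relabel G e t) :=
  (map_relabel G (X := FreeTerm S) (Y := FreeObj S) (fun _ => FreeObj.mk)
    (fun _ _ _ => rfl) e t).symm

/-- The free operad `𝔽(S)`. -/
noncomputable def freeOperad (S : SymmSeq.{u, v} G) : GOperad.{u, max u v} G where
  obj := FreeObj S
  one := FreeObj.mk .one
  γ := FreeObj.comp
  smul_one g := FreeObj.sound (.smul_one g)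
  smul_γ g k j x y := by
    obtain ⟨t, rfl⟩ := x.exists_mk
    choose r hr using fun i => (y i).exists_mk
    obtain rfl : (fun i => FreeObj.mk (r i)) = y := funext hr
    rw [FreeObj.comp_mk]
    exact (FreeObj.sound (.smul_comp g j t r)).trans (FreeObj.comp_mk ..).symm
  γ_perm_left {k} j σ x y := by
    obtain ⟨t, rfl⟩ := x.exists_mk
    choose r hr using fun i => (y i).exists_mk
    obtain rfl : (fun i => FreeObj.mk (r i)) = y := funext hr
    rw [FreeObj.comp_mk (fun i => j (σ i)) t (fun i => r (σ i)), FreeObj.relabel_mk]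
    exact (FreeObj.comp_mk ..).trans (FreeObj.sound (.comp_perm_left j σ t r))
  γ_perm_right {k} j τ x y := by
    obtain ⟨t, rfl⟩ := x.exists_mk
    choose r hr using fun i => (y i).exists_mk
    obtain rfl : (fun i => FreeObj.mk (r i)) = y := funext hr
    rw [FreeObj.comp_mk]
    exact (FreeObj.comp_mk ..).trans (FreeObj.sound (.comp_perm_right j τ t r))
  γ_one {k} x := by
    obtain ⟨t, rfl⟩ := x.exists_mk
    rw [FreeObj.comp_mk (fun _ => 1) t (fun _ => .one), FreeObj.relabel_mk]
    exact FreeObj.sound (.comp_one t)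
  one_γ {n} y := by
    obtain ⟨t, rfl⟩ := y.exists_mk
    rw [FreeObj.comp_mk (fun _ => n) .one (fun _ => t), FreeObj.relabel_mk]
    exact FreeObj.sound (.one_comp t)
  γ_assoc {k} j l x y z := by
    obtain ⟨t, rfl⟩ := x.exists_mk
    choose r hr using fun i => (y i).exists_mk
    obtain rfl : (fun i => FreeObj.mk (r i)) = y := funext hr
    choose q hq using fun i => (z i).exists_mk
    obtain rfl : (fun i => FreeObj.mk (q i)) = z := funext hq
    simp only [FreeObj.comp_mk, FreeObj.relabel_mk]
    exact FreeObj.sound (.comp_assoc j l t r q)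

/-- The unit `η : S → 𝔽(S)` of the free-forgetful adjunction. -/
noncomputable def freeUnit (S : SymmSeq.{u, v} G) : SymmSeq.Hom S (freeOperad S).toSymmSeq where
  toFun _ s := FreeObj.mk (.of s)
  map_smul _ a s := FreeObj.sound (.of_smul a s)

/-- Evaluation of formal expressions in an operad. -/
def FreeTerm.eval {S : SymmSeq.{u, v} G} {O : GOperad.{u, w} G}
    (f : SymmSeq.Hom S O.toSymmSeq) : ∀ {n : ℕ}, FreeTerm S n → O.obj n
  | _, .of s => f.toFun _ s
  | _, .one => O.one
  | _, .smul a t => a • t.eval f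
  | _, .comp j t r => O.γ j (t.eval f) (fun i => (r i).eval f)

theorem FreeTerm.eval_relabel {S : SymmSeq.{u, v} G} {O : GOperad.{u, w} G}
    (f : SymmSeq.Hom S O.toSymmSeq) {m n : ℕ} (e : Fin m ≃ Fin n) (t : FreeTerm S m) :
    (relabel G e t).eval f = relabel G e (t.eval f) :=
  map_relabel G (X := FreeTerm S) (Y := O.obj) (fun _ t => t.eval f) (fun _ _ _ => rfl) e t

theorem FreeRel.eval_eq {S : SymmSeq.{u, v} G} {O : GOperad.{u, w} G}
    (f : SymmSeq.Hom S O.toSymmSeq) {n : ℕ} {t t' : FreeTerm S n} (h : FreeRel S t t') :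
    t.eval f = t'.eval f := by
  induction h with
  | refl t => rfl
  | symm _ ih => exact ih.symm
  | trans _ _ ih ih' => exact ih.trans ih'
  | smul_congr a _ ih => exact congrArg (a • ·) ih
  | comp_congr j _ _ ih ih' => exact congrArg₂ (O.γ j) ih (funext ih')
  | of_smul a s => exact f.map_smul _ a s
  | one_smul t => exact _root_.one_smul _ (t.eval f)
  | mul_smul a b t => exact SemigroupAction.mul_smul a b (t.eval f)
  | smul_one g => exact O.smul_one g
  | smul_comp g j t r => exact O.smul_γ g j _ _
  | comp_perm_left j σ t r =>
    rw [FreeTerm.eval_relabel]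
    exact O.γ_perm_left j σ (t.eval f) (fun i => (r i).eval f)
  | comp_perm_right j τ t r => exact O.γ_perm_right j τ (t.eval f) (fun i => (r i).eval f)
  | comp_one t =>
    rw [FreeTerm.eval_relabel]
    exact O.γ_one (t.eval f)
  | one_comp t =>
    rw [FreeTerm.eval_relabel]
    exact O.one_γ (t.eval f)
  | comp_assoc j l t r q =>
    rw [FreeTerm.eval_relabel]
    exact O.γ_assoc j l (t.eval f) (fun i => (r i).eval f) (fun a => (q a).eval f)

/-- The universal property of the free operad: `𝔽` is left adjoint to the forgetful functor. -/
theorem freeOperad_existsUnique_hom (S : SymmSeq.{u, v} G) (O : GOperad.{u, w} G)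
    (f : SymmSeq.Hom S O.toSymmSeq) :
    ∃! F : GOperad.Hom (freeOperad S) O,
      ∀ n (s : S.obj n), F.toFun n ((freeUnit S).toFun n s) = f.toFun n s := by
  refine ⟨⟨⟨fun n x => Quotient.lift (s := freeSetoid S n) (fun t => t.eval f)
    (fun _ _ h => FreeRel.eval_eq f h) x, ?_⟩, rfl, ?_⟩, fun _ _ => rfl, ?_⟩
  · rintro n a ⟨t⟩
    rfl
  · intro k j x y
    obtain ⟨t, rfl⟩ := FreeObj.exists_mk x
    choose r hr using fun i => FreeObj.exists_mk (y i)
    obtain rfl : (fun i => FreeObj.mk (r i)) = y := funext hr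
    have h : (freeOperad S).γ j (FreeObj.mk t) (fun i => FreeObj.mk (r i)) =
        FreeObj.mk (.comp j t r) := FreeObj.comp_mk j t r
    rw [h]
    rfl
  · intro F hF
    have key : ∀ {n : ℕ} (t : FreeTerm S n), F.toFun n (FreeObj.mk t) = t.eval f := by
      intro n t
      induction t with
      | of s => exact hF _ s
      | one => exact F.map_one
      | smul a t ih => exact (F.map_smul _ a (FreeObj.mk t)).trans (congrArg (a • ·) ih)
      | comp j t r ih ih' =>
        have h : (freeOperad S).γ j (FreeObj.mk t) (fun i => FreeObj.mk (r i)) =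
            FreeObj.mk (.comp j t r) := FreeObj.comp_mk j t r
        rw [← h]
        exact (F.map_γ j (FreeObj.mk t) (fun i => FreeObj.mk (r i))).trans
          (congrArg₂ (O.γ j) ih (funext ih'))
    apply GOperad.Hom.ext
    funext n x
    obtain ⟨t, rfl⟩ := FreeObj.exists_mk x
    exact key t

end Free

/-! ### Finite `H`-sets and indexing systems -/

/-- A finite `H`-set. -/
structure FinAct (H : Type u) [Group H] where
  carrier : Type u
  [act : MulAction H carrier]
  [fin : Finite carrier]

attribute [instance] FinAct.act FinAct.fin

namespace FinAct

/-- The pullback of an action along a group homomorphism. -/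
def pullback {H K : Type u} [Group H] [Group K] (f : K →* H) (T : FinAct H) : FinAct K :=
  letI : MulAction K T.carrier := MulAction.compHom T.carrier f
  ⟨T.carrier⟩

/-- The disjoint union of two finite `H`-sets. -/
def sum {H : Type u} [Group H] (T T' : FinAct H) : FinAct H := ⟨T.carrier ⊕ T'.carrier⟩

/-- The product of two finite `H`-sets, with the diagonal action. -/
def prod {H : Type u} [Group H] (T T' : FinAct H) : FinAct H := ⟨T.carrier × T'.carrier⟩

variable {G : Type u} [Group G]

/-- The restriction of an `H`-set to a subgroup `K ≤ H`. -/
def res {H K : Subgroup G} (h : K ≤ H) (T : FinAct H) : FinAct K :=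
  T.pullback (Subgroup.inclusion h)

/-- The conjugate of an `H`-set: the `gHg⁻¹`-set on which `ghg⁻¹` acts as `h`. -/
def conj {H : Subgroup G} (g : G) (T : FinAct H) :
    FinAct (H.map (MulAut.conj g).toMonoidHom) :=
  T.pullback ((MulAut.conj g).subgroupMap H).symm.toMonoidHom

/-- The orbit `H/K`. -/
def orbit [Finite G] (H K : Subgroup G) : FinAct H := ⟨H ⧸ K.subgroupOf H⟩

/-- The equivalence relation `(h k, t) ∼ (h, k t)` on `H × T`, for a `K`-set `T`. -/
def indSetoid {H K : Subgroup G} (hK : K ≤ H) (T : FinAct K) : Setoid (H × T.carrier) where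
  r p q := ∃ k : K, p.1 = q.1 * Subgroup.inclusion hK k ∧ q.2 = k • p.2
  iseqv :=
    { refl := fun p => ⟨1, by simp, by simp⟩
      symm := by
        rintro p q ⟨k, h1, h2⟩
        exact ⟨k⁻¹, by rw [h1, map_inv, mul_inv_cancel_right], by rw [h2, inv_smul_smul]⟩
      trans := by
        rintro p q r ⟨k, h1, h2⟩ ⟨k', h1', h2'⟩
        exact ⟨k' * k, by rw [h1, h1', map_mul, mul_assoc], by rw [h2', h2, mul_smul]⟩ }

instance {H K : Subgroup G} (hK : K ≤ H) (T : FinAct K) :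
    MulAction H (Quotient (indSetoid hK T)) where
  smul h := Quotient.map (fun p => (h * p.1, p.2)) (by
    rintro p q ⟨k, h1, h2⟩
    exact ⟨k, by simp only [h1, mul_assoc], h2⟩)
  one_smul := by
    rintro ⟨p⟩
    exact congrArg (Quotient.mk _) (Prod.ext (one_mul p.1) rfl)
  mul_smul := by
    rintro a b ⟨p⟩
    exact congrArg (Quotient.mk _) (Prod.ext (mul_assoc a b p.1) rfl)

/-- The induced `H`-set `H ×_K T` of a `K`-set `T`, for `K ≤ H`. -/
def ind [Finite G] {H K : Subgroup G} (hK : K ≤ H) (T : FinAct K) : FinAct H :=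
  ⟨Quotient (indSetoid hK T)⟩

end FinAct

/-- A graded class of finite `G`-subgroup actions: a class of finite `H`-sets for every
subgroup `H` of `G`. -/
abbrev ActionClass (G : Type u) [Group G] := ∀ H : Subgroup G, Set (FinAct H)

/-- Indexing systems: graded classes of finite `H`-sets that contain all trivial actions and are
closed under subobjects (hence isomorphisms), restriction, conjugation, finite coproducts,
products, and self-induction. -/
structure IsIndexingSystem {G : Type u} [Group G] [Finite G] (F : ActionClass G) : Prop where
  trivial : ∀ (H : Subgroup G) (T : FinAct H), (∀ (h : H) (t : T.carrier), h • t = t) → T ∈ F H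
  sub : ∀ (H : Subgroup G) (T T' : FinAct H) (i : T'.carrier → T.carrier),
    Function.Injective i → (∀ (h : H) (t : T'.carrier), i (h • t) = h • i t) →
      T ∈ F H → T' ∈ F H
  res : ∀ (H K : Subgroup G) (hK : K ≤ H) (T : FinAct H), T ∈ F H → T.res hK ∈ F K
  conj : ∀ (H : Subgroup G) (g : G) (T : FinAct H), T ∈ F H →
    T.conj g ∈ F (H.map (MulAut.conj g).toMonoidHom)
  sum : ∀ (H : Subgroup G) (T T' : FinAct H), T ∈ F H → T' ∈ F H → T.sum T' ∈ F H
  prod : ∀ (H : Subgroup G) (T T' : FinAct H), T ∈ F H → T' ∈ F H → T.prod T' ∈ F H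
  ind : ∀ (H K : Subgroup G) (hK : K ≤ H) (T : FinAct K), T ∈ F K → FinAct.orbit H K ∈ F H →
    T.ind hK ∈ F H

/-- The indexing system `𝕀(C)` generated by `C`: the intersection of all indexing systems that
contain `C`. -/
def generatedIndexingSystem {G : Type u} [Group G] [Finite G] (C : ActionClass G) :
    ActionClass G :=
  fun H => {T | ∀ F : ActionClass G, IsIndexingSystem F → (∀ K, C K ⊆ F K) → T ∈ F H}

/-! ### Admissible sets -/

/-- The graph subgroup `Γ_T = {(h, σ(h)) | h ∈ H}` of `G × Σ_n`, where `σ : H → Σ_n` is the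
permutation representation of `T` with respect to an ordering `e : T ≃ {1, …, n}`. -/
def graphSubgroup {G : Type u} [Group G] {H : Subgroup G} (T : FinAct H) {n : ℕ}
    (e : T.carrier ≃ Fin n) : Subgroup (G × Equiv.Perm (Fin n)) :=
  (H.subtype.prod (e.permCongrHom.toMonoidHom.comp (MulAction.toPermHom H T.carrier))).range

/-- The class `𝔸(S)` of admissible sets of `S`: a finite `H`-set `T` is admissible if `S_n` has
a `Γ_T`-fixed point for an ordering of `T`. (Reordering `T` conjugates `Γ_T` by an element of
`Σ_n`, so the choice of ordering is immaterial.) -/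
def admissibleSets {G : Type u} [Group G] (S : SymmSeq.{u, v} G) : ActionClass G :=
  fun _ => {T | ∃ (n : ℕ) (e : T.carrier ≃ Fin n),
    (MulAction.fixedPoints (graphSubgroup T e) (S.obj n)).Nonempty}

/-!
A morphism of symmetric sequences preserves admissibility, and reflects `Σ`-freeness. So it is
enough to compare `𝔽(S)` with one operad that receives a map from `S` and whose elements can be
taken apart by hand, and to show separately that admissible sets of operads have closure properties.

*Upper bound and freeness.* As `S` is `Σ`-free, choosing a representative in each `Σ_n`-orbit of
`S_n` gives every formal composite of elements of `S` a unique expression as a tree (`OpTree`)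
with nodes labelled by orbits; no further quotient is needed, trees form a monad under substitution,
and the operad axioms for trees in which each of the labels `1, …, n` occurs once (`linTreeOperad`)
reduce to the monad laws. A permutation that fixes such a tree fixes every label, whence freeness.
If `H` acts on the labels and fixes the tree, then it acts on the branches at the root through
an admissible set of `S`, the leaves map equivariantly to the branches, and the stabilizer of
a branch fixes that branch. By induction the leaves lie in `𝕀(𝔸(S))`
(`OpTree.leaves_mem_of_fixed`), since an indexing system is closed under extensions: an `H`-set with
a map to a member is a member as soon as the fibres are
(`IsIndexingSystem.closedUnderExtensions`).

*Lower bound.* The admissible sets of any operad are closed under extensions, by composition of the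
operations involved (`GOperad.closedUnderExtensions_admissibleSets`). If the operad has `G`-fixed
operations of all arities, trivial actions are admissible, and each closure property of an indexing
system other than restriction and conjugation is a case of an extension
(`GOperad.isIndexingSystem_admissibleSets`). In `𝔽(S)` the fixed operations are composites of
the given ones of arities `0` and `2` and the identity.
-/

/-! ### Relabelling inputs -/

section Relabel

variable {G : Type u} [Group G] {X : ℕ → Type v} [∀ n, MulAction (G × Equiv.Perm (Fin n)) (X n)]

theorem relabel_trans {l m n : ℕ} (e : Fin l ≃ Fin m) (e' : Fin m ≃ Fin n) (x : X l) :
    relabel G e' (relabel G e x) = relabel G (e.trans e') x := by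
  obtain rfl : l = m := Fin.equiv_iff_eq.mp ⟨e⟩
  obtain rfl : l = n := Fin.equiv_iff_eq.mp ⟨e'⟩
  rw [relabel_perm, relabel_perm, relabel_perm, smul_smul]
  simp [Equiv.Perm.mul_def]

theorem smul_eq_relabel {n : ℕ} (g : G) (σ : Equiv.Perm (Fin n)) (x : X n) :
    (g, σ) • x = relabel G σ ((g, (1 : Equiv.Perm (Fin n))) • x) := by
  rw [relabel_perm, smul_smul]
  simp

end Relabel

/-! ### Composites fixed by graph subgroups -/

namespace GOperad

variable {G : Type u} [Group G] (O : GOperad.{u, v} G)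

/-- Equivariance of `γ` in its inner operations, for bijections between different standard
finite sets instead of permutations. -/
theorem γ_relabel {k : ℕ} {j j' : Fin k → ℕ} (θ : ∀ i, Fin (j i) ≃ Fin (j' i)) (x : O.obj k)
    (y : ∀ i, O.obj (j i)) :
    O.γ j' x (fun i => relabel G (θ i) (y i)) =
      relabel G (finSigmaFinEquiv.symm.trans ((Equiv.sigmaCongrRight θ).trans finSigmaFinEquiv))
        (O.γ j x y) := by
  obtain rfl : j = j' := funext fun i => Fin.equiv_iff_eq.mp ⟨θ i⟩
  exact O.γ_perm_right j θ x y

/-- If `(g, σ)` fixes `x` and carries the family `y` to itself by way of the bijections `θ`, then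
it fixes the composite `γ(x; y)`, acting on the inputs of the latter through `σ` and `θ`. -/
theorem smul_γ_eq_self {k : ℕ} (j : Fin k → ℕ) (x : O.obj k) (y : ∀ i, O.obj (j i)) (g : G)
    (σ : Equiv.Perm (Fin k)) (θ : ∀ i, Fin (j i) ≃ Fin (j (σ i))) (hx : (g, σ) • x = x)
    (hy : ∀ i, relabel G (θ i) ((g, (1 : Equiv.Perm (Fin (j i)))) • y i) = y (σ i))
    (π : Equiv.Perm (Fin (∑ i, j i)))
    (hπ : ∀ i b, π (finSigmaFinEquiv ⟨i, b⟩) = finSigmaFinEquiv ⟨σ i, θ i b⟩) :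
    (g, π) • O.γ j x y = O.γ j x y := by
  have hx' : ((1 : G), σ) • (g, (1 : Equiv.Perm (Fin k))) • x = x := by
    rw [smul_smul]
    simpa using hx
  conv_rhs => rw [← hx', O.γ_perm_left]
  simp only [← hy]
  rw [γ_relabel, ← O.smul_γ, relabel_trans, smul_eq_relabel]
  congr 1
  ext a : 1
  obtain ⟨⟨i, b⟩, rfl⟩ := finSigmaFinEquiv.surjective a
  rw [hπ]
  simp [blockPerm]

end GOperad

/-! ### Admissible sets -/

section Admissible

variable {G : Type u} [Group G]

theorem mem_admissibleSets_iff {S : SymmSeq.{u, v} G} {H : Subgroup G} {T : FinAct H} :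
    T ∈ admissibleSets S H ↔ ∃ (n : ℕ) (e : T.carrier ≃ Fin n) (x : S.obj n),
      ∀ h : H, ((h : G), e.permCongr (MulAction.toPerm h)) • x = x := by
  refine exists_congr fun n => exists_congr fun e => exists_congr fun x => ⟨fun hx h => ?_, ?_⟩
  · exact hx ⟨_, ⟨h, rfl⟩⟩
  · rintro hx ⟨_, ⟨h, rfl⟩⟩
    exact hx h

theorem admissibleSets_mono {S : SymmSeq.{u, v} G} {S' : SymmSeq.{u, w} G} (f : SymmSeq.Hom S S')
    (H : Subgroup G) : admissibleSets S H ⊆ admissibleSets S' H := by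
  intro T hT
  obtain ⟨n, e, x, hx⟩ := mem_admissibleSets_iff.mp hT
  exact mem_admissibleSets_iff.mpr
    ⟨n, e, f.toFun n x, fun h => (f.map_smul _ _ _).symm.trans (congrArg _ (hx h))⟩

theorem SymmSeq.SigmaFree.of_hom {S : SymmSeq.{u, v} G} {S' : SymmSeq.{u, w} G}
    (f : SymmSeq.Hom S S') (h : S'.SigmaFree) : S.SigmaFree := fun n x σ hσ =>
  h n (f.toFun n x) σ ((f.map_smul _ _ _).symm.trans (congrArg _ hσ))

/-- The fibre over `z` of an equivariant map `p` out of the `H`-set `L` belongs to the class `C`,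
as a set acted on by the stabilizer of `z`. The fibre is presented by a set `T` with an
action of a subgroup `K` that contains the stabilizer and an equivariant bijection `i` of `T` with
the fibre (so that `K` is the stabilizer unless the fibre is empty). -/
def FiberMem (C : ActionClass G) {H : Subgroup G} (L : FinAct H) {Z : Type w} [MulAction H Z]
    (p : L.carrier → Z) (z : Z) : Prop :=
  ∃ (K : Subgroup G) (hK : K ≤ H) (T : FinAct K) (i : T.carrier → L.carrier),
    T ∈ C K ∧ (∀ h : H, h • z = z → (h : G) ∈ K) ∧ Function.Injective i ∧
      (∀ (k : K) t, i (k • t) = Subgroup.inclusion hK k • i t) ∧ ∀ l, p l = z ↔ ∃ t, i t = l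

/-- A class of finite actions is closed under extensions if it contains every `H`-set with an
equivariant map to a member whose fibres, over at least one point of every orbit,
are members. -/
def ClosedUnderExtensions (C : ActionClass G) : Prop :=
  ∀ (H : Subgroup G) (L Z : FinAct H) (p : L.carrier → Z.carrier),
    (∀ (h : H) l, p (h • l) = h • p l) → Z ∈ C H → (∀ z, ∃ h : H, FiberMem C L p (h • z)) →
      L ∈ C H

theorem FiberMem.exists_orbit_rep {C : ActionClass G} {H : Subgroup G} {L : FinAct H} {Z : Type w}
    [MulAction H Z] {p : L.carrier → Z} (hp : ∀ z, ∃ h : H, FiberMem C L p (h • z))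
    (c : MulAction.orbitRel.Quotient H Z) :
    ∃ z : Z, (Quotient.mk _ z : MulAction.orbitRel.Quotient H Z) = c ∧ FiberMem C L p z := by
  obtain ⟨z, rfl⟩ := Quotient.exists_rep c
  obtain ⟨h, hh⟩ := hp z
  exact ⟨h • z, Quotient.sound ⟨h, rfl⟩, hh⟩

/-- The fibre of an admissible family in coordinates: its points are listed by `f`, and the
operation `y` is fixed by the stabilizer of `z`. -/
theorem FiberMem.exists_coordinates {S : SymmSeq.{u, v} G} {H : Subgroup G} {L : FinAct H}
    {Z : Type w} [MulAction H Z] {p : L.carrier → Z} {z : Z}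
    (hz : FiberMem (admissibleSets S) L p z) :
    ∃ (n : ℕ) (f : Fin n → L.carrier) (y : S.obj n), Function.Injective f ∧
      (∀ l, p l = z ↔ ∃ a, f a = l) ∧
      ∀ (h : H) (σ : Equiv.Perm (Fin n)), h • z = z → (∀ a, f (σ a) = h • f a) →
        ((h : G), σ) • y = y := by
  obtain ⟨K, hK, T, i, hT, hstab, hi, hequiv, hr⟩ := hz
  obtain ⟨n, e, y, hy⟩ := mem_admissibleSets_iff.mp hT
  refine ⟨n, i ∘ e.symm, y, hi.comp e.symm.injective, fun l => (hr l).trans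
    ⟨fun ⟨t, ht⟩ => ⟨e t, by simpa using ht⟩, fun ⟨a, ha⟩ => ⟨_, ha⟩⟩, fun h σ hz hσ => ?_⟩
  have := hy ⟨h, hstab h hz⟩
  convert this using 3
  ext a : 1
  apply e.symm.injective
  apply hi
  rw [Equiv.permCongr_apply, Equiv.symm_apply_apply, MulAction.toPerm_apply, hequiv]
  exact hσ a

/-- If `Z` is admissible by way of `x` and the fibres of `L → Z` are admissible by way of
operations `y`, then `L` is admissible by way of `γ(x; y)`, once the `y` are chosen on
one point of every orbit and transported along the orbit. -/
theorem GOperad.closedUnderExtensions_admissibleSets (O : GOperad.{u, v} G) :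
    ClosedUnderExtensions (admissibleSets O.toSymmSeq) := by
  intro H L Z p hp hZ hfib
  obtain ⟨k, e, x, hx⟩ := mem_admissibleSets_iff.mp hZ
  choose w hw hwfib using FiberMem.exists_orbit_rep hfib
  choose N f y hf hfr hy using fun c => (hwfib c).exists_coordinates
  let q : Z.carrier → MulAction.orbitRel.Quotient H Z.carrier := fun z => Quotient.mk _ z
  have hq : ∀ (h : H) z, q (h • z) = q z := fun h z => Quotient.sound ⟨h, rfl⟩
  have ha : ∀ z, ∃ a : H, a • w (q z) = z := fun z =>
    Quotient.exact (s := MulAction.orbitRel H Z.carrier) (hw (q z)).symm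
  choose a ha using ha
  -- The transported listing and the transported operation.
  let F : ∀ z, Fin (N (q z)) → L.carrier := fun z b => a z • f (q z) b
  let Y : ∀ z, O.obj (N (q z)) := fun z =>
    ((a z : G), (1 : Equiv.Perm (Fin (N (q z))))) • y (q z)
  have hF : ∀ z, Function.Injective (F z) := fun z =>
    (MulAction.injective (a z)).comp (hf (q z))
  have hFr : ∀ z l, p l = z ↔ ∃ b, F z b = l := by
    intro z l
    have h1 : p l = z ↔ p ((a z)⁻¹ • l) = w (q z) := by
      rw [hp, inv_smul_eq_iff, ha]
    rw [h1, hfr]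
    exact exists_congr fun b => eq_inv_smul_iff
  -- Two lists along the same orbit differ by an element of the stabilizer.
  have hY : ∀ (h : H) z (θ : Fin (N (q z)) ≃ Fin (N (q (h • z)))),
      (∀ b, F (h • z) (θ b) = h • F z b) →
        relabel G θ (((h : G), (1 : Equiv.Perm (Fin (N (q z))))) • Y z) = Y (h • z) := by
    have key : ∀ (h : H) c c' (_ : c' = c) (a a' : H) (_ : a' • w c' = h • a • w c)
        (θ : Fin (N c) ≃ Fin (N c')), (∀ b, a' • f c' (θ b) = h • a • f c b) →
        relabel G θ (((h : G), (1 : Equiv.Perm (Fin (N c)))) •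
          ((a : G), (1 : Equiv.Perm (Fin (N c)))) • y c) =
            ((a' : G), (1 : Equiv.Perm (Fin (N c')))) • y c' := by
      rintro h c _ rfl a a' hw θ hθ
      have h1 := hy _ (a'⁻¹ * h * a) θ (by rw [mul_smul, mul_smul, ← hw, inv_smul_smul])
        (fun b => by rw [mul_smul, mul_smul, ← hθ, inv_smul_smul])
      conv_rhs => rw [← h1]
      rw [relabel_perm, smul_smul, smul_smul, smul_smul]
      congr 1
      ext1
      · simp [mul_assoc]
      · simp
    intro h z θ hθ
    exact key h _ _ (hq h z) _ _ (by rw [ha, ha]) θ hθ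
  have hθ : ∀ (h : H) z, ∃ θ : Fin (N (q z)) ≃ Fin (N (q (h • z))),
      ∀ b, F (h • z) (θ b) = h • F z b := by
    intro h z
    have h1 : ∀ b, ∃ b', F (h • z) b' = h • F z b := fun b =>
      (hFr _ _).mp (by rw [hp, (hFr z _).mpr ⟨b, rfl⟩])
    choose θ hθ using h1
    refine ⟨Equiv.ofBijective θ ⟨fun b b' hb => hF z (MulAction.injective h ?_), fun b => ?_⟩, hθ⟩
    · show h • F z b = h • F z b'
      rw [← hθ, ← hθ, hb]
    · obtain ⟨b', hb'⟩ := (hFr z (h⁻¹ • F (h • z) b)).mp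
        (by rw [hp, (hFr (h • z) _).mpr ⟨b, rfl⟩, inv_smul_smul])
      exact ⟨b', hF _ (by rw [hθ, hb', smul_inv_smul])⟩
  choose θ hθ using hθ
  -- The points of `L` are listed block by block.
  let E : (Σ i : Fin k, Fin (N (q (e.symm i)))) ≃ L.carrier :=
    Equiv.ofBijective (fun b => F (e.symm b.1) b.2) <| by
      constructor
      · rintro ⟨i, b⟩ ⟨i', b'⟩ h
        obtain rfl : i = i' := by
          apply e.symm.injective
          rw [← (hFr _ _).mpr ⟨b, rfl⟩, ← (hFr _ _).mpr ⟨b', rfl⟩]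
          exact congrArg p h
        exact congrArg _ (hF _ h)
      · intro l
        obtain ⟨b, hb⟩ := (hFr (e.symm (e (p l))) l).mp (e.symm_apply_apply _).symm
        exact ⟨⟨e (p l), b⟩, hb⟩
  refine mem_admissibleSets_iff.mpr ⟨_, E.symm.trans finSigmaFinEquiv,
    O.γ (fun i => N (q (e.symm i))) x (fun i => Y (e.symm i)), fun h => ?_⟩
  have hσ : ∀ i, h • e.symm i = e.symm (e.permCongr (MulAction.toPerm h) i) := fun i => by simp
  have key : ∀ i, ∃ θ : Fin (N (q (e.symm i))) ≃
      Fin (N (q (e.symm (e.permCongr (MulAction.toPerm h) i)))),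
      (∀ b, F (e.symm (e.permCongr (MulAction.toPerm h) i)) (θ b) = h • F (e.symm i) b) ∧
      relabel G θ (((h : G), (1 : Equiv.Perm (Fin (N (q (e.symm i)))))) • Y (e.symm i)) =
        Y (e.symm (e.permCongr (MulAction.toPerm h) i)) := by
    intro i
    rw [← hσ]
    exact ⟨θ h _, hθ h _, hY h _ _ (hθ h _)⟩
  choose θ' hθ' hθY using key
  refine O.smul_γ_eq_self _ x _ h _ θ' (hx h) hθY _ fun i b => ?_
  simp only [Equiv.permCongr_apply, Equiv.symm_trans_apply, Equiv.symm_symm,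
    Equiv.symm_apply_apply, Equiv.trans_apply, EmbeddingLike.apply_eq_iff_eq,
    MulAction.toPerm_apply]
  rw [Equiv.symm_apply_eq]
  exact (hθ' i b).symm

/-- The set `A` with the trivial action. -/
def FinAct.triv (H : Type u) [Group H] (A : Type u) [Finite A] : FinAct H :=
  letI : MulAction H A :=
    { smul := fun _ t => t, one_smul := fun _ => rfl, mul_smul := fun _ _ _ => rfl }
  ⟨A⟩

theorem mem_admissibleSets_of_trivial {S : SymmSeq.{u, v} G} (hS : ∀ n, (S.gFixed n).Nonempty)
    {H : Subgroup G} {T : FinAct H} (hT : ∀ (h : H) (t : T.carrier), h • t = t) :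
    T ∈ admissibleSets S H := by
  obtain ⟨n, ⟨e⟩⟩ := Finite.exists_equiv_fin T.carrier
  obtain ⟨x, hx⟩ := hS n
  refine mem_admissibleSets_iff.mpr ⟨n, e, x, fun h => ?_⟩
  convert hx h using 3
  ext a : 1
  simp [hT]

/-- The admissible sets of an operad with a `G`-fixed operation of every arity form an indexing
system: subobjects, coproducts, products and self-inductions are all extensions, over the ambient
set, a trivial two-point set, a factor and an orbit respectively. -/
theorem GOperad.isIndexingSystem_admissibleSets [Finite G] (O : GOperad.{u, v} G)
    (hO : ∀ n, (O.toSymmSeq.gFixed n).Nonempty) :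
    IsIndexingSystem (admissibleSets O.toSymmSeq) where
  trivial _ _ hT := mem_admissibleSets_of_trivial hO hT
  sub H T T' i hi hequiv hT := by
    refine O.closedUnderExtensions_admissibleSets H T' T i hequiv hT fun z => ⟨1, ?_⟩
    rw [one_smul]
    refine ⟨(MulAction.stabilizer H z).map H.subtype, Subgroup.map_subtype_le _,
      FinAct.triv _ {t // i t = z}, Subtype.val, mem_admissibleSets_of_trivial hO fun _ _ => rfl,
      fun h hh => ⟨h, hh, rfl⟩, Subtype.val_injective, ?_, ?_⟩
    · rintro ⟨_, h, hh, rfl⟩ ⟨t, ht⟩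
      apply hi
      rw [hequiv]
      show i t = h • i t
      rw [ht]
      exact hh.symm
    · exact fun l => ⟨fun h => ⟨⟨l, h⟩, rfl⟩, fun ⟨t, h⟩ => h ▸ t.2⟩
  res H K hK T hT := by
    obtain ⟨n, e, x, hx⟩ := mem_admissibleSets_iff.mp hT
    exact mem_admissibleSets_iff.mpr ⟨n, e, x, fun h => hx (Subgroup.inclusion hK h)⟩
  conj H g T hT := by
    obtain ⟨n, e, x, hx⟩ := mem_admissibleSets_iff.mp hT
    refine mem_admissibleSets_iff.mpr
      ⟨n, e, (g, (1 : Equiv.Perm (Fin n))) • x, fun h => ?_⟩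
    obtain ⟨h, rfl⟩ := ((MulAut.conj g).subgroupMap H).surjective h
    have h1 := hx h
    conv_rhs => rw [← h1]
    rw [smul_smul, smul_smul]
    congr 1
    ext1
    · simp
    · simp only [Prod.mk_mul_mk, mul_one, one_mul]
      congr 1
      ext t
      exact congrArg (fun h' : H => h' • (show T.carrier from t))
        (((MulAut.conj g).subgroupMap H).symm_apply_apply h)
  sum H T T' hT hT' := by
    refine O.closedUnderExtensions_admissibleSets H (T.sum T') (FinAct.triv H (ULift Bool))
      (fun t => ⟨t.isLeft⟩) ?_ (mem_admissibleSets_of_trivial hO fun _ _ => rfl) ?_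
    · rintro h (t | t) <;> rfl
    · rintro ⟨z⟩
      refine ⟨1, H, le_rfl, ?_⟩
      cases z
      · refine ⟨T', Sum.inr, hT', fun h _ => h.2, Sum.inr_injective, fun _ _ => rfl, ?_⟩
        rintro (t | t)
        · exact ⟨fun h => Bool.noConfusion (congrArg ULift.down h : true = false),
            fun ⟨_, h⟩ => nomatch h⟩
        · exact ⟨fun _ => ⟨t, rfl⟩, fun _ => rfl⟩
      · refine ⟨T, Sum.inl, hT, fun h _ => h.2, Sum.inl_injective, fun _ _ => rfl, ?_⟩
        rintro (t | t)
        · exact ⟨fun _ => ⟨t, rfl⟩, fun _ => rfl⟩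
        · exact ⟨fun h => Bool.noConfusion (congrArg ULift.down h : false = true),
            fun ⟨_, h⟩ => nomatch h⟩
  prod H T T' hT hT' := by
    refine O.closedUnderExtensions_admissibleSets H (T.prod T') T Prod.fst (fun _ _ => rfl) hT
      fun z => ⟨1, ?_⟩
    have hK : (MulAction.stabilizer H z).map H.subtype ≤ H := Subgroup.map_subtype_le _
    rw [one_smul]
    obtain ⟨n, e, x, hx⟩ := mem_admissibleSets_iff.mp hT'
    refine ⟨_, hK, T'.res hK, fun t => (z, t),
      mem_admissibleSets_iff.mpr ⟨n, e, x, fun h => hx (Subgroup.inclusion hK h)⟩,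
      fun h hh => ⟨h, hh, rfl⟩, fun t t' h => congrArg Prod.snd h, ?_, ?_⟩
    · rintro ⟨_, h, hh, rfl⟩ t
      exact Prod.ext (Eq.symm hh) rfl
    · rintro ⟨t, t'⟩
      exact ⟨fun h => ⟨t', Prod.ext h.symm rfl⟩, fun ⟨s, h⟩ => (congrArg Prod.fst h).symm⟩
  ind H K hK T hT horb := by
    refine O.closedUnderExtensions_admissibleSets H (T.ind hK) (FinAct.orbit H K)
      (Quotient.lift (fun p => (p.1 : H ⧸ K.subgroupOf H)) ?_) ?_ horb ?_
    · rintro ⟨h, t⟩ ⟨h', t'⟩ ⟨k, h1, h2⟩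
      refine QuotientGroup.eq.mpr ?_
      simp only at h1
      simp [h1, Subgroup.mem_subgroupOf]
    · rintro h ⟨p⟩
      rfl
    · intro z
      obtain ⟨g, rfl⟩ := QuotientGroup.mk_surjective z
      refine ⟨g⁻¹, K, hK, T, fun t => Quotient.mk _ (1, t), hT, ?_, ?_, ?_, ?_⟩
      · intro h hh
        have h1 : ((h * (g⁻¹ * g) : H) : H ⧸ K.subgroupOf H) = ((g⁻¹ * g : H) : H ⧸ _) := hh
        rw [inv_mul_cancel, mul_one] at h1
        have h2 := QuotientGroup.eq.mp h1
        simpa [Subgroup.mem_subgroupOf] using h2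
      · intro t t' h
        obtain ⟨k, h1, h2⟩ := Quotient.exact h
        have : k = 1 := by
          have h3 : Subgroup.inclusion hK k = 1 := by simpa using h1.symm
          exact (Subgroup.inclusion_injective hK) (by rw [h3, map_one])
        simpa [this] using h2.symm
      · intro k t
        refine Quotient.sound ⟨k⁻¹, ?_, ?_⟩
        · simp
        · simp
      · rintro ⟨h, t⟩
        constructor
        · intro hh
          have h1 : ((h : H) : H ⧸ K.subgroupOf H) = ((g⁻¹ * g : H) : H ⧸ _) := hh
          rw [inv_mul_cancel] at h1
          have h2 : (h : G) ∈ K := by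
            have := QuotientGroup.eq.mp h1
            simpa [Subgroup.mem_subgroupOf] using this
          refine ⟨(⟨h, h2⟩ : K) • t, Quotient.sound ⟨(⟨h, h2⟩ : K)⁻¹, ?_, ?_⟩⟩
          · rw [← mul_inv_eq_one]
            ext
            simp
          · simp
        · rintro ⟨s, hs⟩
          rw [← hs]
          show ((1 : H) : H ⧸ K.subgroupOf H) = ((g⁻¹ * g : H) : H ⧸ _)
          rw [inv_mul_cancel]

end Admissible

/-! ### Extensions in indexing systems -/

section IndexingSystem

variable {G : Type u} [Group G]

/-- The disjoint union of a finite family of finite `H`-sets. -/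
def FinAct.sigma {H : Type u} [Group H] {ι : Type u} [Finite ι] (A : ι → FinAct H) : FinAct H :=
  ⟨Σ i, (A i).carrier⟩

variable [Finite G]

theorem IsIndexingSystem.sigma {F : ActionClass G} (hF : IsIndexingSystem F) {H : Subgroup G}
    {ι : Type u} [Finite ι] (A : ι → FinAct H) (hA : ∀ i, A i ∈ F H) : FinAct.sigma A ∈ F H := by
  suffices h : ∀ (_ : Finite ι) (A : ι → FinAct H), (∀ i, A i ∈ F H) → FinAct.sigma A ∈ F H from
    h inferInstance A hA
  clear hA A
  refine Finite.induction_empty_option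
    (P := fun ι => ∀ (_ : Finite ι) (A : ι → FinAct H), (∀ i, A i ∈ F H) → FinAct.sigma A ∈ F H)
    ?_ ?_ ?_ ι
  · intro α β e ih _ A hA
    have : Finite α := Finite.of_equiv β e.symm
    let E := Equiv.sigmaCongrLeft (β := fun b => (A b).carrier) e
    refine hF.sub H (FinAct.sigma fun a => A (e a)) _ E.symm E.symm.injective ?_
      (ih this _ fun a => hA _)
    intro h t
    obtain ⟨s, rfl⟩ := E.surjective t
    exact (E.symm_apply_apply (h • s : Σ a, (A (e a)).carrier)).trans
      (congrArg (fun s' : Σ a, (A (e a)).carrier => h • s') (E.symm_apply_apply s).symm)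
  · intro _ A _
    exact hF.trivial H _ fun _ t => t.1.elim
  · intro α _ ih _ A hA
    refine hF.sub H ((A none).sum (FinAct.sigma fun a => A (some a))) _
      (fun | ⟨none, t⟩ => .inl t | ⟨some a, t⟩ => .inr ⟨a, t⟩) ?_ ?_
      (hF.sum H _ _ (hA none) (ih inferInstance _ fun a => hA _))
    · rintro ⟨_ | a, t⟩ ⟨_ | b, s⟩ h
      · cases h
        rfl
      · cases h
      · cases h
      · cases h
        rfl
    · rintro h ⟨_ | a, t⟩ <;> rfl

/-- An equivariant map to `Z` exhibits its source as the disjoint union, over representatives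
of the orbits of `Z`, of the sets induced from the fibres. -/
theorem IsIndexingSystem.closedUnderExtensions {F : ActionClass G} (hF : IsIndexingSystem F) :
    ClosedUnderExtensions F := by
  intro H L Z p hp hZ hfib
  choose w hw hwfib using FiberMem.exists_orbit_rep hfib
  choose K hK T i hT hstab hi hequiv hr using hwfib
  have hpi : ∀ c t, p (i c t) = w c := fun c t => (hr c _).mpr ⟨t, rfl⟩
  have hKstab : ∀ c (_ : Nonempty (T c).carrier) (k : K c),
      Subgroup.inclusion (hK c) k • w c = w c := fun c ⟨t⟩ k => by
    rw [← hpi c t, ← hp, ← hequiv, hpi, hpi]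
  have : Finite (MulAction.orbitRel.Quotient H Z.carrier) := Quotient.finite _
  -- The group that presents an empty fibre is not determined by it, so empty fibres are left out.
  let ι := {c : MulAction.orbitRel.Quotient H Z.carrier // Nonempty (T c).carrier}
  let A : ι → FinAct H := fun c => (T c.1).ind (hK c.1)
  have horb : ∀ c : ι, FinAct.orbit H (K c.1) ∈ F H := by
    rintro ⟨c, hc⟩
    have hwd : ∀ h h' : H, (h : H ⧸ (K c).subgroupOf H) = h' ↔ h • w c = h' • w c := by
      intro h h'
      rw [QuotientGroup.eq, Subgroup.mem_subgroupOf, eq_comm, ← inv_smul_eq_iff, smul_smul]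
      exact ⟨fun hk => hKstab c hc ⟨_, hk⟩, fun hk => hstab c _ hk⟩
    refine hF.sub H Z _ (Quotient.lift (fun h : H => h • w c) fun h h' hh =>
      (hwd h h').mp (Quotient.sound hh)) ?_ ?_ hZ
    · rintro ⟨h⟩ ⟨h'⟩ hh
      exact (hwd h h').mpr hh
    · rintro h ⟨h'⟩
      exact mul_smul h h' (w c)
  have hA : ∀ c, A c ∈ F H := fun c => hF.ind H _ (hK c.1) _ (hT c.1) (horb c)
  let φ : (FinAct.sigma A).carrier → L.carrier := fun x =>
    Quotient.lift (s := FinAct.indSetoid (hK x.1.1) (T x.1.1)) (fun q => q.1 • i x.1.1 q.2) (by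
      rintro ⟨h, t⟩ ⟨h', t'⟩ ⟨k, h1, h2⟩
      simp only at h1 h2 ⊢
      rw [h1, h2, hequiv, mul_smul]) x.2
  have hφ : Function.Bijective φ := by
    constructor
    · rintro ⟨⟨c, hc⟩, ⟨h, t⟩⟩ ⟨⟨c', hc'⟩, ⟨h', t'⟩⟩ heq
      have heq' : h • i c t = h' • i c' t' := heq
      have hpw : h • w c = h' • w c' := by
        rw [← hpi c t, ← hpi c' t', ← hp, ← hp, heq']
      obtain rfl : c = c' := by
        rw [← hw c, ← hw c']
        refine Quotient.sound ⟨h⁻¹ * h', ?_⟩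
        simp only
        rw [mul_smul, ← hpw, inv_smul_smul]
      have hk : ((h'⁻¹ * h : H) : G) ∈ K c :=
        hstab c _ (by rw [mul_smul, hpw, inv_smul_smul])
      have : (Quotient.mk _ (h, t) : ((T c).ind (hK c)).carrier) = Quotient.mk _ (h', t') := by
        refine Quotient.sound ⟨⟨_, hk⟩, ?_, ?_⟩
        · ext
          simp
        · apply hi c
          rw [hequiv]
          have : Subgroup.inclusion (hK c) ⟨_, hk⟩ = h'⁻¹ * h := rfl
          simp only [this]
          rw [mul_smul, heq', inv_smul_smul]
      exact congrArg (Sigma.mk (β := fun c : ι => (A c).carrier) ⟨c, hc⟩) this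
    · intro l
      let c : MulAction.orbitRel.Quotient H Z.carrier := Quotient.mk _ (p l)
      obtain ⟨h, hh⟩ := Quotient.exact (s := MulAction.orbitRel H Z.carrier) (hw c)
      obtain ⟨t, ht⟩ := (hr c (h • l)).mp (by rw [hp]; exact hh)
      refine ⟨⟨⟨c, ⟨t⟩⟩, Quotient.mk _ (h⁻¹, t)⟩, ?_⟩
      show h⁻¹ • i c t = l
      rw [ht, inv_smul_smul]
  have hφequiv : ∀ (h : H) x, φ (h • x) = h • φ x := by
    rintro h ⟨c, ⟨h', t⟩⟩
    exact mul_smul h h' (i c.1 t)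
  let E := Equiv.ofBijective φ hφ
  refine hF.sub H _ L E.symm E.symm.injective (fun h l => ?_) (hF.sigma A hA)
  apply hφ.1
  rw [hφequiv]
  exact (E.apply_symm_apply _).trans (congrArg (h • ·) (E.apply_symm_apply _).symm)

end IndexingSystem

/-! ### Trees -/

section Trees

variable {G : Type u} [Group G]

/-- Two operations are related if they differ by a permutation of their inputs. -/
def symmSetoid (S : SymmSeq.{u, v} G) (n : ℕ) : Setoid (S.obj n) where
  r s s' := ∃ σ : Equiv.Perm (Fin n), ((1 : G), σ) • s' = s
  iseqv :=
    { refl := fun s => ⟨1, one_smul _ s⟩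
      symm := by
        rintro s s' ⟨σ, rfl⟩
        exact ⟨σ⁻¹, by rw [smul_smul, Prod.mk_mul_mk, one_mul, inv_mul_cancel]; exact one_smul _ _⟩
      trans := by
        rintro s s' s'' ⟨σ, rfl⟩ ⟨τ, rfl⟩
        exact ⟨σ * τ, by simp [smul_smul]⟩ }

/-- The orbit set `S_n / Σ_n`. -/
def SymmOrbit (S : SymmSeq.{u, v} G) (n : ℕ) : Type v := Quotient (symmSetoid S n)

namespace SymmOrbit

variable {S : SymmSeq.{u, v} G} {n : ℕ}

/-- The orbit of an operation. -/
def mk (s : S.obj n) : SymmOrbit S n := Quotient.mk (symmSetoid S n) s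

/-- The chosen representative of an orbit. -/
noncomputable def rep (c : SymmOrbit S n) : S.obj n := Quotient.out (s := symmSetoid S n) c

theorem mk_rep (c : SymmOrbit S n) : mk c.rep = c := Quotient.out_eq (s := symmSetoid S n) c

theorem mk_smul (σ : Equiv.Perm (Fin n)) (s : S.obj n) : mk (((1 : G), σ) • s) = mk s :=
  Quotient.sound (s := symmSetoid S n) ⟨σ, rfl⟩

theorem exists_perm (s : S.obj n) : ∃ σ : Equiv.Perm (Fin n), ((1 : G), σ) • (mk s).rep = s :=
  Quotient.exact (s := symmSetoid S n) (mk_rep (mk s)).symm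

/-- The permutation that carries the chosen representative of the orbit of `s` to `s`. -/
noncomputable def perm (s : S.obj n) : Equiv.Perm (Fin n) := (exists_perm s).choose

theorem perm_smul_rep (s : S.obj n) : ((1 : G), perm s) • (mk s).rep = s :=
  (exists_perm s).choose_spec

end SymmOrbit

theorem SymmSeq.SigmaFree.perm_injective {S : SymmSeq.{u, v} G} (hS : S.SigmaFree) {n : ℕ}
    {s : S.obj n} {g : G} {σ τ : Equiv.Perm (Fin n)} (h : (g, σ) • s = (g, τ) • s) : σ = τ := by
  refine inv_mul_eq_one.mp (hS n s (σ⁻¹ * τ) ?_)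
  rw [show ((1 : G), σ⁻¹ * τ) = (g, σ)⁻¹ * (g, τ) by simp, mul_smul, ← h, inv_smul_smul]

theorem SymmSeq.SigmaFree.perm_smul {S : SymmSeq.{u, v} G} (hS : S.SigmaFree) {n : ℕ}
    (σ : Equiv.Perm (Fin n)) (s : S.obj n) :
    SymmOrbit.perm (((1 : G), σ) • s) = σ * SymmOrbit.perm s := by
  refine hS.perm_injective (s := (SymmOrbit.mk s).rep) (g := 1) ?_
  have h := SymmOrbit.perm_smul_rep (((1 : G), σ) • s)
  rw [SymmOrbit.mk_smul] at h
  rw [h, show ((1 : G), σ * SymmOrbit.perm s) = (1, σ) * (1, SymmOrbit.perm s) by simp, mul_smul,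
    SymmOrbit.perm_smul_rep]

/-- Trees with leaves labelled in `X` whose `n`-ary nodes are labelled by `Σ_n`-orbits of `S_n`.
A node stands for the chosen representative of its orbit, so that, when `S` is
`Σ`-free, every formal composite of operations in `S` and variables in `X` is written
in exactly one way. -/
inductive OpTree (S : SymmSeq.{u, v} G) (X : Type w) : Type (max v w)
  | leaf (x : X) : OpTree S X
  | node {n : ℕ} (c : SymmOrbit S n) (f : Fin n → OpTree S X) : OpTree S X

namespace OpTree

variable {S : SymmSeq.{u, v} G} {X Y Z : Type*}

/-- The operation `s` applied to the trees `f`. -/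
noncomputable def app {n : ℕ} (s : S.obj n) (f : Fin n → OpTree S X) : OpTree S X :=
  node (SymmOrbit.mk s) (fun a => f (SymmOrbit.perm s a))

theorem app_smul (hS : S.SigmaFree) {n : ℕ} (σ : Equiv.Perm (Fin n)) (s : S.obj n)
    (f : Fin n → OpTree S X) : app (((1 : G), σ) • s) f = app s (fun a => f (σ a)) := by
  rw [app, app, SymmOrbit.mk_smul, hS.perm_smul]
  rfl

theorem app_rep (hS : S.SigmaFree) {n : ℕ} (c : SymmOrbit S n) (f : Fin n → OpTree S X) :
    app c.rep f = node c f := by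
  have h : SymmOrbit.perm c.rep = 1 := hS n c.rep _ (by
    have := SymmOrbit.perm_smul_rep c.rep
    rwa [SymmOrbit.mk_rep] at this)
  rw [app, h, SymmOrbit.mk_rep]
  rfl

/-- Substitution of trees for the leaves of a tree. -/
def bind : OpTree S X → (X → OpTree S Y) → OpTree S Y
  | leaf x, k => k x
  | node c f, k => node c (fun a => (f a).bind k)

/-- Relabelling of the leaves. -/
def map (k : X → Y) (t : OpTree S X) : OpTree S Y := t.bind (fun x => leaf (k x))

theorem bind_assoc (t : OpTree S X) (k : X → OpTree S Y) (l : Y → OpTree S Z) :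
    (t.bind k).bind l = t.bind (fun x => (k x).bind l) := by
  induction t with
  | leaf x => rfl
  | node c f ih => simp only [bind, ih]

theorem bind_leaf (t : OpTree S X) : t.bind leaf = t := by
  induction t with
  | leaf x => rfl
  | node c f ih => simp only [bind, ih]

theorem map_map (t : OpTree S X) (k : X → Y) (l : Y → Z) :
    (t.map k).map l = t.map (fun x => l (k x)) :=
  bind_assoc _ _ _

theorem map_bind (t : OpTree S X) (k : X → OpTree S Y) (l : Y → Z) :
    (t.bind k).map l = t.bind (fun x => (k x).map l) :=
  bind_assoc _ _ _

theorem bind_map (t : OpTree S X) (k : X → Y) (l : Y → OpTree S Z) :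
    (t.map k).bind l = t.bind (fun x => l (k x)) :=
  bind_assoc _ _ _

/-- The action of `G` on trees, which acts on the operations at the nodes. -/
noncomputable def gsmul (g : G) : OpTree S X → OpTree S X
  | leaf x => leaf x
  | node (n := n) c f =>
    app ((g, (1 : Equiv.Perm (Fin n))) • c.rep) (fun a => (f a).gsmul g)

theorem gsmul_app (hS : S.SigmaFree) (g : G) {n : ℕ} (s : S.obj n) (f : Fin n → OpTree S X) :
    (app s f).gsmul g =
      app ((g, (1 : Equiv.Perm (Fin n))) • s) (fun a => (f a).gsmul g) := by
  conv_rhs => rw [← SymmOrbit.perm_smul_rep s, smul_smul, Prod.mk_mul_mk, mul_one, one_mul]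
  rw [show ((g, SymmOrbit.perm s) : G × Equiv.Perm (Fin n)) = (1, SymmOrbit.perm s) * (g, 1) by
    simp, mul_smul, app_smul hS]
  rfl

theorem one_gsmul (hS : S.SigmaFree) (t : OpTree S X) : t.gsmul (1 : G) = t := by
  induction t with
  | leaf x => rfl
  | node c f ih =>
    simp only [gsmul, ih]
    exact (congrArg (app · f) (one_smul _ c.rep)).trans (app_rep hS c f)

theorem mul_gsmul (hS : S.SigmaFree) (g h : G) (t : OpTree S X) :
    t.gsmul (g * h) = (t.gsmul h).gsmul g := by
  induction t with
  | leaf x => rfl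
  | node c f ih =>
    simp only [gsmul, ih]
    rw [gsmul_app hS, smul_smul, Prod.mk_mul_mk, one_mul]

theorem gsmul_bind (g : G) (t : OpTree S X) (k : X → OpTree S Y) :
    (t.bind k).gsmul g = (t.gsmul g).bind (fun x => (k x).gsmul g) := by
  induction t with
  | leaf x => rfl
  | node c f ih => simp only [bind, gsmul, app, ih]

theorem gsmul_map (g : G) (t : OpTree S X) (k : X → Y) :
    (t.map k).gsmul g = (t.gsmul g).map k :=
  gsmul_bind g t _

open Classical in
/-- The number of leaves with the label `x`. -/
noncomputable def count (x : X) : OpTree S X → ℕ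
  | leaf y => if y = x then 1 else 0
  | node _ f => ∑ a, (f a).count x

theorem count_leaf (x y : X) [Decidable (y = x)] :
    (leaf y : OpTree S X).count x = if y = x then 1 else 0 := by
  unfold count
  congr

theorem count_node {n : ℕ} (c : SymmOrbit S n) (f : Fin n → OpTree S X) (x : X) :
    (node c f).count x = ∑ a, (f a).count x := rfl

theorem count_gsmul (g : G) (t : OpTree S X) (x : X) : (t.gsmul g).count x = t.count x := by
  induction t with
  | leaf y => rfl
  | node c f ih =>
    simp only [gsmul, app, count, ih]
    exact Equiv.sum_comp (SymmOrbit.perm _) fun a => (f a).count x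

theorem count_bind [Fintype X] (t : OpTree S X) (k : X → OpTree S Y) (y : Y) :
    (t.bind k).count y = ∑ x, t.count x * (k x).count y := by
  induction t with
  | leaf x =>
    classical simp [bind, count_leaf]
  | node c f ih =>
    simp only [bind, count, ih, Finset.sum_mul]
    exact Finset.sum_comm

theorem count_map_of_injective {k : X → Y} (hk : Function.Injective k) (t : OpTree S X) (x : X) :
    (t.map k).count (k x) = t.count x := by
  unfold map
  induction t with
  | leaf y => classical simp [bind, count_leaf, hk.eq_iff]
  | node c f ih => simp only [bind, count, ih]

theorem eq_of_map_eq_map {k l : X → Y} {t : OpTree S X} (h : t.map k = t.map l) {x : X}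
    (hx : t.count x ≠ 0) : k x = l x := by
  unfold map at h
  induction t with
  | leaf y =>
    obtain rfl : y = x := by classical simpa [count_leaf] using hx
    simpa [bind] using h
  | node c f ih =>
    obtain ⟨a, -, ha⟩ := Finset.exists_ne_zero_of_sum_ne_zero hx
    simp only [bind, node.injEq, heq_eq_eq, true_and] at h
    exact ih a (congrFun h a) ha

end OpTree

/-! ### The operad of linear trees -/

/-- The trees in which each of the labels `1, …, n` occurs at exactly one leaf. -/
@[ext]
structure LinTree (S : SymmSeq.{u, v} G) (n : ℕ) : Type v where
  tree : OpTree S (Fin n)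
  count_eq_one : ∀ x, tree.count x = 1

namespace LinTree

variable {S : SymmSeq.{u, v} G} [hS : Fact S.SigmaFree]

/-- `G` acts on the nodes and `Σ_n` on the leaves of linear trees. -/
noncomputable instance (n : ℕ) : MulAction (G × Equiv.Perm (Fin n)) (LinTree S n) where
  smul a t := ⟨(t.tree.gsmul a.1).map a.2, fun x => by
    obtain ⟨x, rfl⟩ := a.2.surjective x
    rw [OpTree.count_map_of_injective a.2.injective, OpTree.count_gsmul, t.count_eq_one]⟩
  one_smul t := LinTree.ext ((OpTree.bind_leaf _).trans (OpTree.one_gsmul hS.out t.tree))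
  mul_smul a b t := LinTree.ext (by
    show (t.tree.gsmul (a.1 * b.1)).map (fun x => a.2 (b.2 x)) =
      (((t.tree.gsmul b.1).map b.2).gsmul a.1).map a.2
    rw [OpTree.gsmul_map, OpTree.map_map, OpTree.mul_gsmul hS.out])

theorem tree_smul {n : ℕ} (g : G) (σ : Equiv.Perm (Fin n)) (t : LinTree S n) :
    ((g, σ) • t).tree = (t.tree.gsmul g).map σ := rfl

theorem tree_perm_smul {n : ℕ} (σ : Equiv.Perm (Fin n)) (t : LinTree S n) :
    (((1 : G), σ) • t).tree = t.tree.map σ := by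
  rw [tree_smul, OpTree.one_gsmul hS.out]

theorem tree_gsmul {n : ℕ} (g : G) (t : LinTree S n) :
    ((g, (1 : Equiv.Perm (Fin n))) • t).tree = t.tree.gsmul g :=
  OpTree.bind_leaf _

theorem tree_relabel {m n : ℕ} (e : Fin m ≃ Fin n) (t : LinTree S m) :
    (relabel G e t : LinTree S n).tree = t.tree.map e := by
  obtain rfl : m = n := Fin.equiv_iff_eq.mp ⟨e⟩
  exact tree_perm_smul e t

/-- Grafting of the trees `y` into the leaves of `t`. -/
noncomputable def graft {k : ℕ} (j : Fin k → ℕ) (t : LinTree S k) (y : ∀ i, LinTree S (j i)) :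
    LinTree S (∑ i, j i) :=
  ⟨t.tree.bind fun i => (y i).tree.map fun b => finSigmaFinEquiv ⟨i, b⟩, fun x => by
    rw [OpTree.count_bind]
    simp only [count_eq_one, OpTree.map, OpTree.count_bind, one_mul, OpTree.count_leaf]
    rw [← Fintype.sum_sigma' (fun i b => if finSigmaFinEquiv (⟨i, b⟩ : Σ i, Fin (j i)) = x
      then 1 else 0)]
    simp [← Equiv.eq_symm_apply]⟩

end LinTree

/-- The operad of linear trees, with grafting as composition. -/
noncomputable def linTreeOperad (S : SymmSeq.{u, v} G) [hS : Fact S.SigmaFree] :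
    GOperad.{u, v} G where
  obj := LinTree S
  one := ⟨.leaf 0, fun x => by rw [Subsingleton.elim x 0, OpTree.count_leaf, if_pos rfl]⟩
  γ := LinTree.graft
  smul_one g := rfl
  smul_γ g k j x y := LinTree.ext <| by
    simp only [LinTree.graft, LinTree.tree_gsmul, OpTree.gsmul_bind, OpTree.gsmul_map]
  γ_perm_left j σ x y := LinTree.ext <| by
    simp only [LinTree.tree_relabel, LinTree.graft, LinTree.tree_perm_smul, OpTree.bind_map,
      OpTree.map_bind, OpTree.map_map]
    simp [blockPerm]
  γ_perm_right j τ x y := LinTree.ext <| by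
    simp only [LinTree.graft, LinTree.tree_perm_smul, OpTree.map_bind, OpTree.map_map]
    simp [blockSum]
  γ_one {k} x := LinTree.ext <| by
    rw [LinTree.tree_relabel]
    refine (OpTree.map_bind _ _ _).trans (Eq.trans ?_ (OpTree.bind_leaf x.tree))
    simp [OpTree.map, OpTree.bind, sumOnes]
  one_γ {n} y := LinTree.ext <| by
    rw [LinTree.tree_relabel]
    refine (OpTree.map_map _ _ _).trans (Eq.trans ?_ (OpTree.bind_leaf y.tree))
    simp [OpTree.map, sumSingle]
    rfl
  γ_assoc j l x y z := LinTree.ext <| by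
    simp only [LinTree.tree_relabel, LinTree.graft, OpTree.bind_map, OpTree.map_bind,
      OpTree.map_map, OpTree.bind_assoc]
    simp [sumAssoc]
    rfl

theorem linTreeOperad_sigmaFree (S : SymmSeq.{u, v} G) [hS : Fact S.SigmaFree] :
    (linTreeOperad S).toSymmSeq.SigmaFree := by
  intro n (t : LinTree S n) σ h
  have h' : t.tree.map σ = t.tree.map id := by
    rw [← LinTree.tree_perm_smul]
    exact (congrArg LinTree.tree h).trans (OpTree.bind_leaf t.tree).symm
  ext x : 1
  exact OpTree.eq_of_map_eq_map h' (by rw [t.count_eq_one]; exact one_ne_zero)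

/-- The inclusion of `S` in the operad of linear trees, as the trees with one node. -/
noncomputable def linTreeUnit (S : SymmSeq.{u, v} G) [hS : Fact S.SigmaFree] :
    SymmSeq.Hom S (linTreeOperad S).toSymmSeq where
  toFun n s := (⟨OpTree.app s OpTree.leaf, fun x => by
    simp only [OpTree.app, OpTree.count_node, OpTree.count_leaf]
    simp [← Equiv.eq_symm_apply]⟩ : LinTree S n)
  map_smul n a s := LinTree.ext <| by
    obtain ⟨g, σ⟩ := a
    refine Eq.trans ?_ (congrArg (OpTree.map σ) (OpTree.gsmul_app hS.out g s OpTree.leaf)).symm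
    show OpTree.app ((g, σ) • s) OpTree.leaf = _
    rw [show (g, σ) = ((1 : G), σ) * (g, 1) by simp, mul_smul, OpTree.app_smul hS.out]
    rfl

end Trees

/-! ### Symmetries of linear trees -/

section Symmetries

variable {G : Type u} [Group G]

theorem inclusion_smul_of_mem_stabilizer {H : Subgroup G} {Z : Type w} [MulAction H Z] {z : Z}
    (k : (MulAction.stabilizer H z).map H.subtype) :
    Subgroup.inclusion (Subgroup.map_subtype_le _) k • z = z := by
  obtain ⟨_, h, hh, rfl⟩ := k
  exact hh

/-- The fibre of an equivariant map over `z`, as a set acted on by the stabilizer of `z`. -/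
def FinAct.fiber {H : Subgroup G} (L : FinAct H) {Z : Type w} [MulAction H Z] (p : L.carrier → Z)
    (hp : ∀ (h : H) l, p (h • l) = h • p l) (z : Z) :
    FinAct ((MulAction.stabilizer H z).map H.subtype) :=
  letI : MulAction ((MulAction.stabilizer H z).map H.subtype) {l // p l = z} :=
    { smul := fun k l => ⟨Subgroup.inclusion (Subgroup.map_subtype_le _) k • l.1, by
        rw [hp, l.2, inclusion_smul_of_mem_stabilizer]⟩
      one_smul := fun l => Subtype.ext (one_smul H l.1)
      mul_smul := fun k k' l => Subtype.ext (mul_smul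
        (Subgroup.inclusion (Subgroup.map_subtype_le _) k)
        (Subgroup.inclusion (Subgroup.map_subtype_le _) k') l.1) }
  ⟨{l // p l = z}⟩

theorem fiberMem_of_fiber {C : ActionClass G} {H : Subgroup G} {L : FinAct H} {Z : Type w}
    [MulAction H Z] {p : L.carrier → Z} {hp : ∀ (h : H) l, p (h • l) = h • p l} {z : Z}
    (h : L.fiber p hp z ∈ C _) : FiberMem C L p z :=
  ⟨_, Subgroup.map_subtype_le _, L.fiber p hp z, Subtype.val, h, fun h hh => ⟨h, hh, rfl⟩,
    Subtype.val_injective, fun _ _ => rfl,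
    fun l => ⟨fun h => ⟨⟨l, h⟩, rfl⟩, fun ⟨t, ht⟩ => ht ▸ t.2⟩⟩

variable [Finite G] {S : SymmSeq.{u, v} G}

/-- If `H` acts on the labels of a tree without repeated labels in such a way that the tree is
fixed, then every `H`-set of leaves belongs to every indexing system that contains the admissible
sets of `S`. Indeed `H` fixes the orbit at the root, and by freeness this makes the set of branches
into an admissible `H`-set; the leaves map to the branches that they lie on, and the
stabilizer of a branch fixes that branch, so that induction applies to the fibres. -/
theorem OpTree.leaves_mem_of_fixed (hS : S.SigmaFree) {F : ActionClass G}
    (hF : IsIndexingSystem F) (hSF : ∀ K, admissibleSets S K ⊆ F K) {X : Type w} (t : OpTree S X)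
    (ht : ∀ x, t.count x ≤ 1) {H : Subgroup G} (ρ : H →* Equiv.Perm X)
    (hfix : ∀ h : H, (t.gsmul (h : G)).map (ρ h) = t) (L : FinAct H) (i : L.carrier → X)
    (hi : Function.Injective i) (hequiv : ∀ (h : H) l, i (h • l) = ρ h (i l))
    (hleaf : ∀ l, t.count (i l) ≠ 0) : L ∈ F H := by
  induction t generalizing H with
  | leaf x =>
    have hl : ∀ l, i l = x := fun l => by
      have := hleaf l
      classical
      rw [count_leaf] at this
      exact (ite_ne_right_iff.mp this).1.symm
    exact hF.trivial H L fun h l => hi ((hl _).trans (hl l).symm)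
  | node c f ih =>
    rename_i n
    have hroot : ∀ h : H, ∃ τ : Equiv.Perm (Fin n), ((h : G), τ) • c.rep = c.rep ∧
        ∀ a, ((f a).gsmul (h : G)).map (ρ h) = f (τ a) := by
      intro h
      have h1 := hfix h
      simp only [gsmul, app, map, bind, node.injEq, heq_eq_eq, true_and] at h1
      obtain ⟨hc, hf⟩ := h1
      have h2 := SymmOrbit.perm_smul_rep (((h : G), (1 : Equiv.Perm (Fin n))) • c.rep)
      rw [hc] at h2
      set σ := SymmOrbit.perm (((h : G), (1 : Equiv.Perm (Fin n))) • c.rep)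
      refine ⟨σ⁻¹, ?_, fun a => ?_⟩
      · rw [show ((h : G), σ⁻¹) = ((1 : G), σ)⁻¹ * ((h : G), 1) by simp, mul_smul, ← h2, inv_smul_smul]
      · have h3 := congrFun hf (σ⁻¹ a)
        rwa [show σ (σ⁻¹ a) = a from σ.apply_symm_apply a] at h3
    choose τ hτ hfτ using hroot
    have hτ_mul : ∀ h h', τ (h * h') = τ h * τ h' := fun h h' => by
      refine hS.perm_injective (s := c.rep) (g := h * h') ?_
      rw [← Prod.mk_mul_mk, mul_smul, hτ h', hτ h]
      exact hτ (h * h')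
    have hτ_one : τ 1 = 1 := mul_eq_left.mp ((hτ_mul 1 1).symm.trans (by rw [mul_one]))
    obtain ⟨Z, ε, hε⟩ : ∃ (Z : FinAct H) (ε : Z.carrier ≃ Fin n),
        ∀ (h : H) z, ε (h • z) = τ h (ε z) :=
      letI : MulAction H (ULift.{u} (Fin n)) :=
        { smul := fun h a => ⟨τ h a.down⟩
          one_smul := fun a => congrArg ULift.up (by rw [hτ_one]; rfl)
          mul_smul := fun h h' a => congrArg ULift.up (by rw [hτ_mul]; rfl) }
      ⟨⟨ULift.{u} (Fin n)⟩, Equiv.ulift, fun _ _ => rfl⟩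
    have hZ : Z ∈ F H := by
      refine hSF H (mem_admissibleSets_iff.mpr ⟨n, ε, c.rep, fun h => ?_⟩)
      convert hτ h using 3
      ext a : 1
      simp [hε]
    -- Every leaf lies on one branch.
    have hp : ∀ l, ∃ a, (f a).count (i l) ≠ 0 := fun l => by
      obtain ⟨a, -, ha⟩ := Finset.exists_ne_zero_of_sum_ne_zero (hleaf l)
      exact ⟨a, ha⟩
    have hunique : ∀ {x a b}, (f a).count x ≠ 0 → (f b).count x ≠ 0 → a = b := by
      intro x a b ha hb
      by_contra hab
      have h1 : ∑ d ∈ {a, b}, (f d).count x ≤ ∑ d, (f d).count x :=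
        Finset.sum_le_sum_of_subset (Finset.subset_univ _)
      rw [Finset.sum_pair hab, ← count_node c f x] at h1
      have := ht x
      omega
    choose p hp using hp
    have hpequiv : ∀ (h : H) l, ε.symm (p (h • l)) = h • ε.symm (p l) := by
      intro h l
      rw [Equiv.symm_apply_eq, hε, Equiv.apply_symm_apply]
      refine hunique (hp (h • l)) ?_
      rw [hequiv, ← hfτ, count_map_of_injective (ρ h).injective, count_gsmul]
      exact hp l
    refine hF.closedUnderExtensions H L Z (fun l => ε.symm (p l)) hpequiv hZ fun z => ⟨1, ?_⟩
    rw [one_smul]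
    refine fiberMem_of_fiber (hp := hpequiv) ?_
    have hK : (MulAction.stabilizer H z).map H.subtype ≤ H := Subgroup.map_subtype_le _
    refine ih (ε z) (fun x => ?_) (ρ.comp (Subgroup.inclusion hK)) (fun k => ?_) _
      (fun l => i l.1) (hi.comp Subtype.val_injective) (fun k l => hequiv _ _) ?_
    · exact (Finset.single_le_sum (f := fun a => (f a).count x) (fun _ _ => Nat.zero_le _)
        (Finset.mem_univ _)).trans (ht x)
    · refine (hfτ (Subgroup.inclusion hK k) _).trans (congrArg f ?_)
      rw [← hε, inclusion_smul_of_mem_stabilizer]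
    · rintro ⟨l, hl⟩
      have := hp l
      rwa [show p l = ε z from (Equiv.symm_apply_eq ε).mp hl] at this

theorem admissibleSets_linTreeOperad_subset [hS : Fact S.SigmaFree] (H : Subgroup G) :
    admissibleSets (linTreeOperad S).toSymmSeq H ⊆
      generatedIndexingSystem (admissibleSets S) H := by
  intro T hT F hF hSF
  obtain ⟨n, e, t, ht⟩ := mem_admissibleSets_iff.mp hT
  refine OpTree.leaves_mem_of_fixed hS.out hF hSF (LinTree.tree t)
    (fun x => (LinTree.count_eq_one t x).le)
    (e.permCongrHom.toMonoidHom.comp (MulAction.toPermHom H T.carrier))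
    (fun h => congrArg LinTree.tree (ht h)) T e e.injective (fun h l => ?_) (fun l => ?_)
  · exact congrArg (fun l' => e (h • l')) (e.symm_apply_apply l).symm
  · rw [LinTree.count_eq_one t]
    exact one_ne_zero

end Symmetries

/-! ### The free operad -/

section FreeOperad

variable {G : Type u} [Group G]

/-- Grafting into a `G`-fixed binary operation raises the arity of a `G`-fixed operation by one. -/
theorem GOperad.gFixed_nonempty_of_zero_of_two (O : GOperad.{u, v} G)
    (h0 : (O.toSymmSeq.gFixed 0).Nonempty) (h2 : (O.toSymmSeq.gFixed 2).Nonempty) (n : ℕ) :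
    (O.toSymmSeq.gFixed n).Nonempty := by
  induction n with
  | zero => exact h0
  | succ n ih =>
    obtain ⟨m, hm⟩ := h2
    obtain ⟨x, hx⟩ := ih
    have hsum : ∑ i : Fin 2, (![n, 1] : Fin 2 → ℕ) i = n + 1 := by simp
    rw [← hsum]
    refine ⟨O.γ ![n, 1] m (Fin.cons x (Fin.cons O.one finZeroElim)), fun g => ?_⟩
    rw [O.smul_γ, hm g]
    congr 1
    funext i
    fin_cases i
    · exact hx g
    · exact O.smul_one g

end FreeOperad

theorem mainTheorem3 {G : Type u} [Group G] [Finite G] (S : SymmSeq.{u, v} G)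
    (hS : S.SigmaFree) (h0 : (S.gFixed 0).Nonempty) (h2 : (S.gFixed 2).Nonempty) :
    (freeOperad S).IsNOperad ∧
      admissibleSets (freeOperad S).toSymmSeq = generatedIndexingSystem (admissibleSets S) := by
  have : Fact S.SigmaFree := ⟨hS⟩
  obtain ⟨φ, -, -⟩ := freeOperad_existsUnique_hom S (linTreeOperad S) (linTreeUnit S)
  have hmap : ∀ n, (S.gFixed n).Nonempty → ((freeOperad S).toSymmSeq.gFixed n).Nonempty := by
    rintro n ⟨x, hx⟩
    exact ⟨(freeUnit S).toFun n x, fun g => by rw [← (freeUnit S).map_smul, hx g]⟩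
  have hfix := (freeOperad S).gFixed_nonempty_of_zero_of_two (hmap 0 h0) (hmap 2 h2)
  refine ⟨⟨(linTreeOperad_sigmaFree S).of_hom φ.toHom, hfix⟩, ?_⟩
  funext H
  apply Set.Subset.antisymm
  · exact (admissibleSets_mono φ.toHom H).trans (admissibleSets_linTreeOperad_subset H)
  · intro T hT
    exact hT _ ((freeOperad S).isIndexingSystem_admissibleSets hfix)
      (admissibleSets_mono (freeUnit S))
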